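/- Let $K$ be a field, $S=K[x_1,\dots,x_n]$, and let $0\le p\le q$ be integers. Let $u_1,\dots,u_q$ and $v_1,\dots,v_p$ be two regular sequences of monomials in $S$ with $u_i\mid v_i$ for all $1\le i\le p$, and put $J=(u_1,\dots,u_q)$ and $I=(v_1,\dots,v_p)$, so that $I\subseteq J$. Assume that $I\ne J$ and that $u_{p+1},\dots,u_q$ is a regular sequence on $S/I$. Then $$\operatorname{sdepth}_S(J/I)=n-p-\left\lfloor\frac{q-p}{2}\right\rfloor .$$ Here a Stanley decomposition of a nonzero finitely generated $\mathbb Z^n$-graded $S$-module $M$ is a finite direct sum decomposition $\mathcal D: M=\bigoplus_{i=1}^r m_iK[Z_i]$ of $\mathbb Z^n$-graded $K$-vector spaces, where each $m_i\in M$ is homogeneous, $Z_i\subseteq\{x_1,\dots,x_n\}$, and $m_iK[Z_i]=\{um_i : u\in K[Z_i]\}$ is a free $K[Z_i]$-module; one puts $\operatorname{sdepth}(\mathcal D)=\min_i|Z_i|$, and $\operatorname{sdepth}_S(M)$ is the maximum of $\operatorname{sdepth}(\mathcal D)$ over all Stanley decompositions $\mathcal D$ of $M$ (in particular, such decompositions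 exist for $M=J/I$). A regular sequence $f_1,\dots,f_k$ on $M$ satisfies, besides the non-zero-divisor conditions, $(f_1,\dots,f_k)M\ne M$. -/

import Mathlib

/-- A monomial of `K[x_1, …, x_n]`: a power product of the variables, with coefficient `1`. -/
def IsMonomial {K : Type*} [Field K] {n : ℕ} (f : MvPolynomial (Fin n) K) : Prop :=
  ∃ a : Fin n →₀ ℕ, f = MvPolynomial.monomial a 1

section Stanley

variable {K : Type*} [Field K] {n : ℕ}
variable {M : Type*} [AddCommGroup M] [Module (MvPolynomial (Fin n) K) M] [Module K M]
  [IsScalarTower K (MvPolynomial (Fin n) K) M]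

/-- The `K`-subspace `m K[Z] = {u m : u ∈ K[Z]}` of `M`, for `m ∈ M` and a set `Z` of variables. -/
noncomputable def stanleySpace (m : M) (Z : Finset (Fin n)) : Submodule K M :=
  (Subalgebra.toSubmodule (MvPolynomial.supported K (Z : Set (Fin n)))).map
    ((LinearMap.toSpanSingleton (MvPolynomial (Fin n) K) M m).restrictScalars K)

/-- A Stanley decomposition `M = ⨁ m_i K[Z_i]` (finitely many summands, indexed by `Fin r`) of an
`S`-module `M` with `ℤⁿ`-grading `ℳ`, where `S = K[x_1, …, x_n]`. Each `m_i` is homogeneous, each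
`m_i K[Z_i]` is free over `K[Z_i]` (that is, `u ↦ u m_i` is injective on `K[Z_i]`), and `M` is the
internal direct sum of these subspaces. As the `m_i` are homogeneous, the summands are graded
subspaces, so this is a decomposition of `ℤⁿ`-graded vector spaces. -/
structure StanleyDecomposition (ℳ : (Fin n → ℤ) → Submodule K M) where
  r : ℕ
  m : Fin r → M
  Z : Fin r → Finset (Fin n)
  homogeneous : ∀ i, ∃ d, m i ∈ ℳ d
  free : ∀ i, Set.InjOn (fun f : MvPolynomial (Fin n) K => f • m i)
    (MvPolynomial.supported K (Z i : Set (Fin n)) : Set (MvPolynomial (Fin n) K))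
  isInternal : DirectSum.IsInternal fun i => stanleySpace (K := K) (m i) (Z i)

/-- The Stanley depth `min_i |Z_i|` of a Stanley decomposition (of a nonzero module; the empty
decomposition of the zero module gets the value `0`). -/
noncomputable def StanleyDecomposition.sdepth {ℳ : (Fin n → ℤ) → Submodule K M}
    (D : StanleyDecomposition ℳ) : ℕ :=
  ⨅ i, (D.Z i).card

/-- The Stanley depth of a `ℤⁿ`-graded module: the maximum of the Stanley depths of its Stanley
decompositions. See `isGreatest_stanleyDepth`: it is a maximum as soon as there is a
decomposition. -/
noncomputable def stanleyDepth (ℳ : (Fin n → ℤ) → Submodule K M) : ℕ :=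
  sSup (Set.range fun D : StanleyDecomposition ℳ => D.sdepth)

theorem isGreatest_stanleyDepth (ℳ : (Fin n → ℤ) → Submodule K M)
    (h : Nonempty (StanleyDecomposition ℳ)) :
    IsGreatest (Set.range fun D : StanleyDecomposition ℳ => D.sdepth) (stanleyDepth ℳ) := by
  have hb : BddAbove (Set.range fun D : StanleyDecomposition ℳ => D.sdepth) := by
    refine ⟨n, ?_⟩
    rintro _ ⟨D, rfl⟩
    by_cases hr : Nonempty (Fin D.r)
    · exact (ciInf_le (OrderBot.bddBelow _) hr.some).trans
        ((Finset.card_le_univ _).trans_eq (Fintype.card_fin n))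
    · rw [not_nonempty_iff] at hr
      simp [StanleyDecomposition.sdepth]
  exact ⟨Nat.sSup_mem (Set.range_nonempty _) hb, fun _ hx => le_csSup hb hx⟩

end Stanley

/-- The `S`-module `J/I` for ideals `I ⊆ J` of `S` (in general it is `J/(I ∩ J)`). -/
abbrev IdealQuotient {S : Type*} [CommRing S] (J I : Ideal S) : Type _ :=
  J ⧸ Submodule.submoduleOf I J

/-- The `ℤⁿ`-grading of `J/I` for monomial ideals `I ⊆ J` of `K[x_1, …, x_n]`: the component of
degree `d` consists of the classes of the elements `c x^d` of `J`, with `c ∈ K`; it is zero when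
`d` has a negative entry. -/
noncomputable def idealQuotientGrading {K : Type*} [Field K] {n : ℕ} (J I : Ideal (MvPolynomial (Fin n) K))
    (d : Fin n → ℤ) : Submodule K (IdealQuotient J I) :=
  Submodule.map ((Submodule.mkQ (Submodule.submoduleOf I J)).restrictScalars K)
    { carrier := {f : J | ∀ e ∈ (f : MvPolynomial (Fin n) K).support, ∀ i, (e i : ℤ) = d i}
      add_mem' := by
        intro f g hf hg e he
        rcases Finset.mem_union.1 (MvPolynomial.support_add he) with h | h
        · exact hf e h
        · exact hg e h
      zero_mem' := by
        intro e he
        simp at he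
      smul_mem' := by
        intro c f hf e he
        exact hf e (MvPolynomial.support_smul he) }

/-! The space `x^a K[Z]` corresponds to the cylinder of exponents above `a` that are frozen to `a`
off `Z`. Stanley decompositions of `J/I` thus amount to finite partitions of the exponents of `J`
outside `I` into cylinders (`exists_stanleyDecomposition`, `StanleyDecomposition.exists_cylinders`),
and the question is how few directions must be frozen. The monomials `v_1, …, v_p, u_{p+1}, …, u_q`
form one weakly regular sequence of non-units, so their supports are disjoint
(`disjointSupports_of_isWeaklyRegular`).

Lower bound: conditions on disjoint sets of variables intersect with additive cost. Divisibility by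
a monomial freezes nothing; its failure, or divisibility by `u_i` but not `v_i`, freezes one
variable per cylinder. The first `p` pairs therefore cost `p`, and `m` remaining monomials should
cost `⌊m/2⌋`. For this an exponent is read as the `0`-`1`-word of its divisibilities, and the
nonzero words are tiled so that each tile costing `1` covers two letters
(`hasCylinderPartition_exists_le`).

Upper bound (`add_card_div_two_le_of_cylinders`): every cylinder has a frozen direction in each
`v_i`. Each remaining generator `w` is the base of its own cylinder. Two such cylinders cannot each
be free along the other's generator, as both would contain `w + w'`. By counting, some `w` has
frozen directions in at least `⌊m/2⌋` of the others. -/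

/-! ### Partitions of exponent sets into cylinders -/

section Cylinders

variable {σ : Type*} [DecidableEq σ]

/-- The exponents above `a` which agree with `a` on `T`. -/
def cylinder (a : σ →₀ ℕ) (T : Finset σ) : Set (σ →₀ ℕ) :=
  {b | a ≤ b ∧ ∀ i ∈ T, b i = a i}

/-- `P` is a finite disjoint union of cylinders `cylinder a T` with `a` and `T` supported in `V`
and `T.card ≤ c`. -/
def HasCylinderPartition (V : Finset σ) (c : ℕ) (P : Set (σ →₀ ℕ)) : Prop :=
  ∃ D : Finset ((σ →₀ ℕ) × Finset σ),
    (∀ d ∈ D, d.1.support ⊆ V ∧ d.2 ⊆ V ∧ d.2.card ≤ c) ∧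
    (∀ b, b ∈ P ↔ ∃ d ∈ D, b ∈ cylinder d.1 d.2) ∧
    ∀ b, ∀ d ∈ D, ∀ d' ∈ D, b ∈ cylinder d.1 d.2 → b ∈ cylinder d'.1 d'.2 → d = d'

namespace HasCylinderPartition

variable {V W : Finset σ} {c c' : ℕ} {P Q : Set (σ →₀ ℕ)}

omit [DecidableEq σ] in
theorem mono (h : HasCylinderPartition V c P) (hV : V ⊆ W) (hc : c ≤ c') :
    HasCylinderPartition W c' P := by
  obtain ⟨D, h1, h2, h3⟩ := h
  exact ⟨D, fun d hd => ⟨(h1 d hd).1.trans hV, (h1 d hd).2.1.trans hV, (h1 d hd).2.2.trans hc⟩,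
    h2, h3⟩

omit [DecidableEq σ] in
theorem empty : HasCylinderPartition V c ∅ :=
  ⟨∅, by simp, by simp, by simp⟩

theorem union (hP : HasCylinderPartition V c P) (hQ : HasCylinderPartition V c Q)
    (hd : Disjoint P Q) : HasCylinderPartition V c (P ∪ Q) := by
  obtain ⟨D, h1, h2, h3⟩ := hP
  obtain ⟨E, k1, k2, k3⟩ := hQ
  refine ⟨D ∪ E, ?_, ?_, ?_⟩
  · intro d hd
    rcases Finset.mem_union.1 hd with h | h
    · exact h1 d h
    · exact k1 d h
  · intro b
    rw [Set.mem_union, h2, k2]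
    simp only [Finset.mem_union, or_and_right, exists_or]
  · intro b d hD d' hD' hb hb'
    rw [Set.disjoint_left] at hd
    rcases Finset.mem_union.1 hD with h | h <;> rcases Finset.mem_union.1 hD' with h' | h'
    · exact h3 b d h d' h' hb hb'
    · exact (hd ((h2 b).2 ⟨d, h, hb⟩) ((k2 b).2 ⟨d', h', hb'⟩)).elim
    · exact (hd ((h2 b).2 ⟨d', h', hb'⟩) ((k2 b).2 ⟨d, h, hb⟩)).elim
    · exact k3 b d h d' h' hb hb'

omit [DecidableEq σ] in
theorem add_le_iff_of_disjoint {a a' b : σ →₀ ℕ} (h : Disjoint a.support a'.support) :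
    a + a' ≤ b ↔ a ≤ b ∧ a' ≤ b := by
  constructor
  · exact fun hb => ⟨le_self_add.trans hb, le_add_self.trans hb⟩
  · rintro ⟨h1, h2⟩ i
    rw [Finset.disjoint_left] at h
    have := h1 i
    have := h2 i
    by_cases hi : a i = 0
    · simpa [hi] using h2 i
    · have : a' i = 0 := by simpa using h (Finsupp.mem_support_iff.2 hi)
      simpa [this] using h1 i

theorem cylinder_add {a a' : σ →₀ ℕ} {T T' : Finset σ} (hVW : Disjoint V W)
    (ha : a.support ⊆ V) (hT : T ⊆ V) (ha' : a'.support ⊆ W) (hT' : T' ⊆ W) :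
    cylinder (a + a') (T ∪ T') = cylinder a T ∩ cylinder a' T' := by
  ext b
  have h0 : ∀ i ∈ T, a' i = 0 := fun i hi => by
    by_contra h
    exact Finset.disjoint_left.1 hVW (hT hi) (ha' (Finsupp.mem_support_iff.2 h))
  have h0' : ∀ i ∈ T', a i = 0 := fun i hi => by
    by_contra h
    exact Finset.disjoint_left.1 hVW (ha (Finsupp.mem_support_iff.2 h)) (hT' hi)
  simp only [cylinder, Set.mem_ofPred_eq, Set.mem_inter_iff,
    add_le_iff_of_disjoint (hVW.mono ha ha')]
  constructor
  · rintro ⟨⟨h1, h2⟩, h⟩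
    exact ⟨⟨h1, fun i hi => by simpa [h0 i hi] using h i (Finset.mem_union_left _ hi)⟩, h2,
      fun i hi => by simpa [h0' i hi] using h i (Finset.mem_union_right _ hi)⟩
  · rintro ⟨⟨h1, h⟩, h2, h'⟩
    refine ⟨⟨h1, h2⟩, fun i hi => ?_⟩
    rcases Finset.mem_union.1 hi with hi | hi
    · simpa [h0 i hi] using h i hi
    · simpa [h0' i hi] using h' i hi

/-- Since the two families involve disjoint sets of variables, cylinders intersect by adding bases
and uniting frozen sets, so the costs add. -/
theorem inter (hP : HasCylinderPartition V c P) (hQ : HasCylinderPartition W c' Q)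
    (hVW : Disjoint V W) : HasCylinderPartition (V ∪ W) (c + c') (P ∩ Q) := by
  obtain ⟨D, h1, h2, h3⟩ := hP
  obtain ⟨E, k1, k2, k3⟩ := hQ
  have key : ∀ d ∈ D, ∀ e ∈ E,
      cylinder (d.1 + e.1) (d.2 ∪ e.2) = cylinder d.1 d.2 ∩ cylinder e.1 e.2 := fun d hd e he =>
    cylinder_add hVW (h1 d hd).1 (h1 d hd).2.1 (k1 e he).1 (k1 e he).2.1
  refine ⟨(D ×ˢ E).image fun x => (x.1.1 + x.2.1, x.1.2 ∪ x.2.2), ?_, ?_, ?_⟩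
  · simp only [Finset.mem_image, Finset.mem_product]
    rintro _ ⟨⟨d, e⟩, ⟨hd, he⟩, rfl⟩
    exact ⟨Finsupp.support_add.trans (Finset.union_subset_union (h1 d hd).1 (k1 e he).1),
      Finset.union_subset_union (h1 d hd).2.1 (k1 e he).2.1,
      (Finset.card_union_le _ _).trans (add_le_add (h1 d hd).2.2 (k1 e he).2.2)⟩
  · intro b
    simp only [Finset.mem_image, Finset.mem_product]
    rw [Set.mem_inter_iff, h2, k2]
    constructor
    · rintro ⟨⟨d, hd, hb⟩, e, he, hb'⟩
      exact ⟨_, ⟨(d, e), ⟨hd, he⟩, rfl⟩, by rw [key d hd e he]; exact ⟨hb, hb'⟩⟩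
    · rintro ⟨_, ⟨⟨d, e⟩, ⟨hd, he⟩, rfl⟩, hb⟩
      rw [key d hd e he] at hb
      exact ⟨⟨d, hd, hb.1⟩, e, he, hb.2⟩
  · simp only [Finset.mem_image, Finset.mem_product]
    rintro b _ ⟨⟨d, e⟩, ⟨hd, he⟩, rfl⟩ _ ⟨⟨d', e'⟩, ⟨hd', he'⟩, rfl⟩ hb hb'
    rw [key d hd e he] at hb
    rw [key d' hd' e' he'] at hb'
    obtain rfl := h3 b d hd d' hd' hb.1 hb'.1
    obtain rfl := k3 b e he e' he' hb.2 hb'.2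
    rfl

omit [DecidableEq σ] in
theorem Ici (a : σ →₀ ℕ) (ha : a.support ⊆ V) : HasCylinderPartition V c (Set.Ici a) :=
  ⟨{(a, ∅)}, by simp [ha], by simp [cylinder], by simp⟩

omit [DecidableEq σ] in
theorem univ : HasCylinderPartition V c (Set.univ : Set (σ →₀ ℕ)) := by
  convert Ici (V := V) (c := c) (0 : σ →₀ ℕ) (by simp)
  ext; simp

theorem slab (x : σ) (k l : ℕ) :
    HasCylinderPartition {x} 1 {b : σ →₀ ℕ | k ≤ b x ∧ b x < l} := by
  refine ⟨(Finset.Ico k l).image fun t => (Finsupp.single x t, {x}), ?_, ?_, ?_⟩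
  · simp only [Finset.mem_image]
    rintro _ ⟨t, -, rfl⟩
    exact ⟨Finsupp.support_single_subset, subset_rfl, by simp⟩
  · intro b
    simp [cylinder]
  · simp only [Finset.mem_image]
    rintro b _ ⟨t, -, rfl⟩ _ ⟨t', -, rfl⟩ hb hb'
    have h1 := hb.2 x (by simp)
    have h2 := hb'.2 x (by simp)
    simp only [Finsupp.single_eq_same] at h1 h2
    rw [← h1, ← h2]

/-- Telescoping over the variables: either the exponent of `x` is below `b x`, and freezing it at
each of finitely many values leaves the other variables free, or it is at least `b x` and the
failure occurs among the remaining variables. Each piece freezes only one variable. -/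
theorem diff_of_finset (s : Finset σ) {a b : σ →₀ ℕ} (hab : a ≤ b) :
    HasCylinderPartition s 1 ({e | ∀ x ∈ s, a x ≤ e x} \ {e | ∀ x ∈ s, b x ≤ e x}) := by
  induction s using Finset.induction with
  | empty => simpa using empty
  | insert x s hx ih =>
    have hxs : Disjoint {x} s := by simpa using hx
    have hs : HasCylinderPartition s 0 {e : σ →₀ ℕ | ∀ x ∈ s, a x ≤ e x} := by
      have h : (Set.Ici (a.filter (· ∈ s))) = {e : σ →₀ ℕ | ∀ x ∈ s, a x ≤ e x} := by
        ext e
        simp only [Set.mem_Ici, Set.mem_ofPred_eq]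
        refine ⟨fun h x hx => by simpa [hx] using h x, fun h x => ?_⟩
        by_cases hx : x ∈ s <;> simp [hx, h]
      rw [← h]
      exact Ici _ fun i hi => by
        by_contra his
        simp [his] at hi
    have hX : HasCylinderPartition {x} 0 {e : σ →₀ ℕ | b x ≤ e x} := by
      have h : Set.Ici (Finsupp.single x (b x)) = {e : σ →₀ ℕ | b x ≤ e x} := by
        ext; simp
      rw [← h]
      exact Ici _ Finsupp.support_single_subset
    have hd : Disjoint ({e : σ →₀ ℕ | a x ≤ e x ∧ e x < b x} ∩ {e | ∀ x ∈ s, a x ≤ e x})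
        ({e | b x ≤ e x} ∩ ({e | ∀ x ∈ s, a x ≤ e x} \ {e | ∀ x ∈ s, b x ≤ e x})) := by
      rw [Set.disjoint_left]
      rintro e ⟨h1, -⟩ ⟨h2, -⟩
      exact absurd h1.2 (not_lt.2 h2)
    have h : HasCylinderPartition (insert x s) 1 _ := ((slab x (a x) (b x)).inter hs hxs).union
      ((hX.inter ih hxs).mono subset_rfl (by simp)) hd
    convert h using 1
    ext e
    simp only [Finset.forall_mem_insert, Set.mem_sdiff, Set.mem_union, Set.mem_inter_iff,
      Set.mem_ofPred_eq]
    have := hab x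
    rcases lt_or_ge (e x) (b x) with h | h
    · simp [h, not_le.2 h]
    · simp [h, not_lt.2 h, this.trans h]

theorem Ici_diff_Ici {a b : σ →₀ ℕ} (hab : a ≤ b) :
    HasCylinderPartition b.support 1 (Set.Ici a \ Set.Ici b) := by
  have key : ∀ a' ≤ b, Set.Ici a' = {e : σ →₀ ℕ | ∀ x ∈ b.support, a' x ≤ e x} := by
    intro a' ha'
    ext e
    refine ⟨fun h x _ => h x, fun h x => ?_⟩
    by_cases hx : b x = 0
    · exact (ha' x).trans (by simp [hx])
    · exact h x (Finsupp.mem_support_iff.2 hx)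
  rw [key a hab, key b le_rfl]
  exact diff_of_finset _ hab

theorem compl_Ici (a : σ →₀ ℕ) : HasCylinderPartition a.support 1 (Set.Ici a)ᶜ := by
  have h := Ici_diff_Ici (bot_le : ⊥ ≤ a)
  rwa [Set.Ici_bot, ← Set.compl_eq_univ_sdiff] at h

end HasCylinderPartition

end Cylinders

/-! ### Tilings of divisibility words -/

section Tilings

variable {σ : Type*} [DecidableEq σ]

/-- The union of the supports of the members of a list of exponents. -/
def listSupport (l : List (σ →₀ ℕ)) : Finset σ :=
  l.foldr (fun w s => w.support ∪ s) ∅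

@[simp] theorem listSupport_nil : listSupport ([] : List (σ →₀ ℕ)) = ∅ := rfl

@[simp] theorem listSupport_cons (w : σ →₀ ℕ) (l : List (σ →₀ ℕ)) :
    listSupport (w :: l) = w.support ∪ listSupport l := rfl

theorem listSupport_append (l l' : List (σ →₀ ℕ)) :
    listSupport (l ++ l') = listSupport l ∪ listSupport l' := by
  induction l with
  | nil => simp
  | cons w l ih => simp [ih]

theorem disjoint_listSupport_right {s : Finset σ} {l : List (σ →₀ ℕ)} :
    Disjoint s (listSupport l) ↔ ∀ w ∈ l, Disjoint s w.support := by
  induction l with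
  | nil => simp
  | cons w l ih => simp [ih]

/-- Members of the list have pairwise disjoint supports. -/
abbrev DisjointSupports (l : List (σ →₀ ℕ)) : Prop :=
  l.Pairwise fun a b => Disjoint a.support b.support

/-- An exponent `e` gives the `0`-`1`-word whose letters tell which `w` in the list are `≤ e`.
This says that the word can be tiled by `1`, `00` and `10`, that is, that it has an even number of
leading zeros. -/
def Tileable (e : σ →₀ ℕ) : List (σ →₀ ℕ) → Prop
  | [] => True
  | w :: l => w ≤ e ∨ ¬ Tileable e l

omit [DecidableEq σ] in
-- Only the leading zeros matter: a `1` in `l` hides `l'`, while a zero word `l` shifts the parity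
-- by its length.
theorem tileable_append (e : σ →₀ ℕ) (l l' : List (σ →₀ ℕ)) :
    ((∃ w ∈ l, w ≤ e) → (Tileable e (l ++ l') ↔ Tileable e l)) ∧
    ((¬ ∃ w ∈ l, w ≤ e) → ((Tileable e l ↔ Even l.length) ∧
      (Tileable e (l ++ l') ↔ (Tileable e l' ↔ Even l.length)))) := by
  induction l with
  | nil => simp [Tileable]
  | cons w l ih =>
    by_cases hw : w ≤ e
    · simp [Tileable, hw]
    · by_cases hl : ∃ w ∈ l, w ≤ e
      · have := ih.1 hl
        simp only [List.cons_append, Tileable, List.mem_cons, exists_eq_or_imp, hw, hl]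
        simp [this]
      · have := ih.2 hl
        simp only [List.cons_append, Tileable, List.mem_cons, exists_eq_or_imp, hw, hl,
          List.length_cons, Nat.even_add_one, this, false_or, not_false_eq_true, true_implies,
          or_self]
        refine ⟨fun h => h.elim, ?_⟩
        by_cases h : Even l.length <;> simp [h]

/-- The first tile is either the letter `1`, of cost `0`, or a pair whose second letter is `0` and
whose first is arbitrary, of cost `1`. The recursive definition makes these two cases exclusive and
exhaustive. -/
theorem hasCylinderPartition_tileable : ∀ l : List (σ →₀ ℕ), DisjointSupports l →
    HasCylinderPartition (listSupport l) (l.length / 2) {e | Tileable e l}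
  | [], _ => by simpa [Tileable] using HasCylinderPartition.univ
  | [w], _ => by
    have : {e | Tileable e [w]} = Set.Ici w := by ext; simp [Tileable]
    rw [this]
    exact .Ici w (by simp)
  | w :: w' :: l, h => by
    obtain ⟨h1, h2⟩ := List.pairwise_cons.1 h
    obtain ⟨h3, h4⟩ := List.pairwise_cons.1 h2
    have e1 := HasCylinderPartition.inter (.Ici (c := 0) w subset_rfl)
      (hasCylinderPartition_tileable (w' :: l) h2) (disjoint_listSupport_right.2 h1)
    have e2 := (HasCylinderPartition.compl_Ici w').inter (hasCylinderPartition_tileable l h4)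
      (disjoint_listSupport_right.2 h3)
    have := (e1.mono (W := listSupport (w :: w' :: l)) (c' := (w :: w' :: l).length / 2)
      (by simp) (by simp only [List.length_cons]; omega)).union
      (e2.mono (by simp) (by simp only [List.length_cons]; omega)) (by
        rw [Set.disjoint_left]
        rintro e ⟨-, ha⟩ ⟨hb, hc⟩
        exact ha.elim hb fun h => h hc)
    convert this using 1
    ext e
    simp only [Tileable, Set.mem_ofPred_eq, Set.mem_union, Set.mem_inter_iff, Set.mem_Ici,
      Set.mem_compl_iff]
    tauto

theorem hasCylinderPartition_exists_le_of_odd (l : List (σ →₀ ℕ)) (h : DisjointSupports l)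
    (hl : Odd l.length) :
    HasCylinderPartition (listSupport l) (l.length / 2) {e | ∃ w ∈ l, w ≤ e} := by
  rcases l with _ | ⟨u, l⟩
  · simp at hl
  rcases List.eq_nil_or_concat l with rfl | ⟨m, w, rfl⟩
  · have : {e | ∃ w ∈ [u], w ≤ e} = Set.Ici u := by ext; simp
    rw [this]
    exact .Ici u (by simp)
  rw [List.concat_eq_append] at *
  have hm : ¬ Even m.length := by
    intro h'
    simp [Nat.odd_add_one, parity_simps, h'] at hl
  have e1 := hasCylinderPartition_tileable _ h
  obtain ⟨h1, h2⟩ := List.pairwise_cons.1 h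
  have h3 := (List.pairwise_append.1 h2).1
  -- The nonzero words that are not tileable have an odd number of leading zeros. Such a word starts
  -- with `0`, and its first `1` lies in `m`, because `m` has odd length. So `w` can stay
  -- unconstrained, which keeps the cost at half the length rounded down.
  have e2 := (HasCylinderPartition.compl_Ici u).inter (hasCylinderPartition_tileable m h3)
    (disjoint_listSupport_right.2 fun w hw => h1 w (by simp [hw]))
  have := e1.union (e2.mono (W := listSupport (u :: (m ++ [w])))
    (c' := (u :: (m ++ [w])).length / 2) (by
      rw [listSupport_cons, listSupport_append]
      exact Finset.union_subset_union subset_rfl Finset.subset_union_left)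
    (by simp only [List.length_cons, List.length_append]; omega)) (by
      rw [Set.disjoint_left]
      rintro e ha ⟨hb, hc⟩
      have k := tileable_append e m [w]
      simp only [Tileable, Set.mem_ofPred_eq, Set.mem_compl_iff, Set.mem_Ici] at ha hb hc k
      by_cases hx : ∃ w ∈ m, w ≤ e
      · have := k.1 hx
        tauto
      · have := k.2 hx
        tauto)
  convert this using 1
  ext e
  have k := tileable_append e m [w]
  simp only [Tileable, Set.mem_ofPred_eq, Set.mem_union, Set.mem_inter_iff, Set.mem_Ici,
      Set.mem_compl_iff, List.mem_cons, List.mem_append, or_and_right, exists_or,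
      exists_eq_left, List.not_mem_nil, false_and, exists_false] at k ⊢
  by_cases hu : u ≤ e
  · simp [hu]
  by_cases hx : ∃ w ∈ m, w ≤ e
  · simp only [hu, hx, k.1 hx]
    tauto
  · simp [hu, hx, k.2 hx, hm]

/-- The exponents of a complete intersection of monomials. -/
theorem hasCylinderPartition_exists_le (l : List (σ →₀ ℕ)) (h : DisjointSupports l) :
    HasCylinderPartition (listSupport l) (l.length / 2) {e | ∃ w ∈ l, w ≤ e} := by
  rcases Nat.even_or_odd l.length with hl | hl
  · rcases l with _ | ⟨u, l⟩
    · simpa using HasCylinderPartition.empty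
    obtain ⟨h1, h2⟩ := List.pairwise_cons.1 h
    have hl' : Odd l.length := by
      rw [List.length_cons, Nat.even_add_one] at hl
      exact Nat.not_even_iff_odd.1 hl
    -- For even length, the cost of a leading `0` is absorbed by the rounding in the odd case.
    have e := (HasCylinderPartition.compl_Ici u).inter
      (hasCylinderPartition_exists_le_of_odd l h2 hl') (disjoint_listSupport_right.2 h1)
    have := (HasCylinderPartition.Ici (V := listSupport (u :: l)) (c := (u :: l).length / 2) u
      (by simp)).union (e.mono subset_rfl (by
        obtain ⟨k, hk⟩ := hl'
        simp only [List.length_cons]; omega)) (by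
        rw [Set.disjoint_left]
        rintro e ha ⟨hb, -⟩
        exact hb ha)
    convert this using 1
    ext e
    simp only [Set.mem_ofPred_eq, Set.mem_union, Set.mem_inter_iff, Set.mem_Ici,
      Set.mem_compl_iff, List.mem_cons, exists_eq_or_imp]
    tauto
  · exact hasCylinderPartition_exists_le_of_odd l h hl

theorem hasCylinderPartition_forall_not_le (l : List (σ →₀ ℕ)) (h : DisjointSupports l) :
    HasCylinderPartition (listSupport l) l.length {e | ∀ w ∈ l, ¬ w ≤ e} := by
  induction l with
  | nil => simpa using HasCylinderPartition.univ
  | cons w l ih =>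
    obtain ⟨h1, h2⟩ := List.pairwise_cons.1 h
    have : HasCylinderPartition (listSupport (w :: l)) _ _ :=
      ((HasCylinderPartition.compl_Ici w).inter (ih h2)
      (disjoint_listSupport_right.2 h1)).mono (c' := (w :: l).length) subset_rfl
      (by simp only [List.length_cons]; omega)
    convert this using 1
    ext e
    simp only [Set.mem_ofPred_eq, Set.mem_inter_iff, Set.mem_compl_iff, Set.mem_Ici,
      List.forall_mem_cons]

/-- The exponents of a quotient of complete intersections, given by a list of pairs `(u, v)` with
`u ∣ v` and further monomials `w`. -/
theorem hasCylinderPartition_quotient (l : List ((σ →₀ ℕ) × (σ →₀ ℕ))) (t : List (σ →₀ ℕ))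
    (hl : ∀ x ∈ l, x.1 ≤ x.2) (h : DisjointSupports (l.map Prod.snd ++ t)) :
    HasCylinderPartition (listSupport (l.map Prod.snd ++ t)) (l.length + t.length / 2)
      {e | ((∃ x ∈ l, x.1 ≤ e) ∨ ∃ w ∈ t, w ≤ e) ∧ ∀ x ∈ l, ¬ x.2 ≤ e} := by
  induction l with
  | nil => simpa using hasCylinderPartition_exists_le t h
  | cons x l ih =>
    obtain ⟨h1, h2⟩ := List.pairwise_cons.1 h
    have hx := hl x (by simp)
    have h3 := (List.pairwise_append.1 h2).1
    -- If `x.1` divides, membership in `J` is settled and only the non-divisibilities remain;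
    -- otherwise `x.2` cannot divide either, and induction applies.
    have e1 := (HasCylinderPartition.Ici_diff_Ici hx).inter
      (hasCylinderPartition_forall_not_le _ h3)
      (disjoint_listSupport_right.2 fun w hw => h1 w (by simp at hw ⊢; tauto))
    have e2 := (HasCylinderPartition.compl_Ici x.1).inter
      (ih (fun y hy => hl y (by simp [hy])) h2)
      ((disjoint_listSupport_right.2 h1).mono_left (Finsupp.support_mono hx))
    have := (e1.mono (W := listSupport ((x :: l).map Prod.snd ++ t))
      (c' := (x :: l).length + t.length / 2) (by
        simp only [List.map_cons, List.cons_append, listSupport_cons, listSupport_append]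
        exact Finset.union_subset_union subset_rfl Finset.subset_union_left)
      (by simp only [List.length_cons, List.length_map]; omega)).union
      (e2.mono (by
        simp only [List.map_cons, List.cons_append, listSupport_cons]
        exact Finset.union_subset_union (Finsupp.support_mono hx) subset_rfl)
        (by simp only [List.length_cons]; omega)) (by
        rw [Set.disjoint_left]
        rintro e ⟨ha, -⟩ ⟨hb, -⟩
        exact hb ha.1)
    convert this using 1
    ext e
    have : x.2 ≤ e → x.1 ≤ e := hx.trans
    simp only [Set.mem_ofPred_eq, Set.mem_union, Set.mem_inter_iff, Set.mem_Ici,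
      Set.mem_compl_iff, Set.mem_sdiff, List.mem_cons, exists_eq_or_imp, forall_eq_or_imp,
      List.forall_mem_map]
    by_cases hxe : x.1 ≤ e
    · simp [hxe]
    · simp [hxe, mt this hxe]

end Tilings

/-! ### Regular sequences of monomials -/

section RegularMonomials

open MvPolynomial RingTheory.Sequence

variable {σ R : Type*} [CommRing R] [Nontrivial R]

theorem monomial_mem_ofList_iff {l : List (σ →₀ ℕ)} {e : σ →₀ ℕ} :
    monomial e (1 : R) ∈ Ideal.ofList (l.map fun w => monomial w (1 : R)) ↔ ∃ w ∈ l, w ≤ e := by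
  classical
  have : Ideal.ofList (l.map fun w => monomial w (1 : R)) =
      Ideal.span ((fun w => monomial w (1 : R)) '' {w | w ∈ l}) := by
    rw [Ideal.ofList]
    congr 1
    ext; simp
  rw [this, mem_ideal_span_monomial_image, support_monomial, if_neg one_ne_zero]
  simp

/-- The exponents of a regular sequence of monomials have disjoint supports. -/
theorem disjointSupports_of_isWeaklyRegular [DecidableEq σ] (l : List (σ →₀ ℕ))
    (h0 : ∀ w ∈ l, w ≠ 0)
    (h : IsWeaklyRegular (MvPolynomial σ R) (l.map fun w => monomial w (1 : R))) :
    DisjointSupports l := by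
  induction l using List.reverseRecOn with
  | nil => exact List.Pairwise.nil
  | append_singleton l w ih =>
    rw [List.map_append, isWeaklyRegular_append_iff] at h
    have hl := ih (fun a ha => h0 a (by simp [ha])) h.1
    refine List.pairwise_append.2 ⟨hl, by simp, ?_⟩
    simp only [List.mem_singleton, forall_eq]
    intro a ha
    rw [Finset.disjoint_left]
    intro x hxa hxw
    have hreg := ((isWeaklyRegular_cons_iff _ _ _).1 h.2).1
    rw [Finsupp.mem_support_iff] at hxa hxw
    -- If `x` divides both `a` and `w`, then `w` times `a / x` is a multiple of `a`. Regularity of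
    -- `w` puts `a / x` in the ideal of `l`, so some `b ≠ a` of `l` divides `a`, although its
    -- nonempty support is disjoint from that of `a`.
    set m := a - Finsupp.single x 1 with hm
    have hmem : monomial m (1 : R) ∈ Ideal.ofList (l.map fun w => monomial w (1 : R)) := by
      have h1 : monomial w (1 : R) • monomial m (1 : R) ∈
          (Ideal.ofList (l.map fun w => monomial w (1 : R)) • ⊤ :
            Submodule (MvPolynomial σ R) (MvPolynomial σ R)) := by
        rw [Ideal.smul_eq_mul, Ideal.mul_top, smul_eq_mul, monomial_mul, mul_one,
          monomial_mem_ofList_iff]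
        refine ⟨a, ha, fun i => ?_⟩
        by_cases hi : x = i
        · subst hi
          simp only [hm, Finsupp.coe_add, Pi.add_apply, Finsupp.coe_tsub, Pi.sub_apply,
            Finsupp.single_eq_same]
          omega
        · simp [hm, hi]
      have h2 := (isSMulRegular_quotient_iff_mem_of_smul_mem _ _).1 hreg _ h1
      rwa [Ideal.smul_eq_mul, Ideal.mul_top] at h2
    obtain ⟨b, hb, hbm⟩ := monomial_mem_ofList_iff.1 hmem
    have hba : b ≤ a := hbm.trans (by rw [hm]; exact tsub_le_self)
    have hne : b ≠ a := by
      rintro rfl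
      have := hbm x
      simp only [hm, Finsupp.coe_tsub, Pi.sub_apply, Finsupp.single_eq_same] at this
      omega
    have : Std.Symm fun a b : σ →₀ ℕ => Disjoint a.support b.support := ⟨fun _ _ h => h.symm⟩
    have hd := (hl.forall hb ha hne).mono_right (Finsupp.support_mono hba)
    exact h0 b (by simp [hb]) (by simpa using hd)

theorem ne_zero_of_isRegular {l : List (σ →₀ ℕ)}
    (h : IsRegular (MvPolynomial σ R) (l.map fun w => monomial w (1 : R))) {w} (hw : w ∈ l) :
    w ≠ 0 := by
  rintro rfl
  refine h.top_ne_smul ?_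
  rw [Ideal.smul_eq_mul, Ideal.mul_top, eq_comm, Ideal.eq_top_iff_one]
  exact monomial_mem_ofList_iff.2 ⟨0, hw, le_rfl⟩

omit [Nontrivial R] in
theorem isWeaklyRegular_append {I : Ideal R} {rs rs' : List R} (hI : I = Ideal.ofList rs)
    (h : IsWeaklyRegular R rs) (h' : IsWeaklyRegular (R ⧸ I) rs') :
    IsWeaklyRegular R (rs ++ rs') := by
  refine (isWeaklyRegular_append_iff _ _ _).2 ⟨h, ?_⟩
  refine ((Submodule.quotEquivOfEq _ _ ?_).isWeaklyRegular_congr rs').1 h'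
  rw [Ideal.smul_eq_mul, Ideal.mul_top, hI]

end RegularMonomials

/-! ### The upper bound by counting frozen directions -/

section Counting

variable {σ : Type*}

theorem card_le_card_of_disjoint_supports {s : Finset (σ →₀ ℕ)} {T : Finset σ}
    (hs : (s : Set (σ →₀ ℕ)).Pairwise fun a b => Disjoint a.support b.support)
    (hT : ∀ w ∈ s, ∃ x ∈ w.support, x ∈ T) : s.card ≤ T.card := by
  rcases s.eq_empty_or_nonempty with rfl | ⟨w, hw⟩
  · simp
  have : Nonempty σ := ⟨(hT w hw).choose⟩
  choose! f hf hfT using hT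
  refine Finset.card_le_card_of_injOn f hfT fun a ha b hb hab => ?_
  by_contra hne
  exact Finset.disjoint_left.1 (hs ha hb hne) (hf a ha) (hab ▸ hf b hb)

/-- In an asymmetric relation some vertex has at most half of the others as out-neighbours. -/
theorem exists_card_filter_lt_of_asymm {α : Type*} [DecidableEq α] {W : Finset α}
    (hW : W.Nonempty)
    (R : α → α → Prop) [DecidableRel R] (hR : ∀ a ∈ W, ∀ b ∈ W, R a b → ¬ R b a) :
    ∃ a ∈ W, 2 * (W.filter (R a)).card + 1 ≤ W.card := by
  by_contra! h
  -- In-degrees and out-degrees have equal sums, and at each vertex they add up to at most `W.card -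
  -- 1`.
  have h1 : ∑ a ∈ W, (W.filter (R a)).card = ∑ a ∈ W, (W.filter fun b => R b a).card :=
    Finset.sum_card_bipartiteAbove_eq_sum_card_bipartiteBelow R
  have h2 : ∀ a ∈ W, (W.filter (R a)).card + (W.filter fun b => R b a).card + 1 ≤ W.card := by
    intro a ha
    rw [← Finset.card_union_of_disjoint]
    · rw [← Finset.card_erase_add_one ha]
      refine Nat.succ_le_succ (Finset.card_le_card fun b hb => ?_)
      simp only [Finset.mem_union, Finset.mem_filter] at hb
      rw [Finset.mem_erase]
      refine ⟨?_, by tauto⟩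
      rintro rfl
      exact hb.elim (fun h => hR _ ha _ ha h.2 h.2) (fun h => hR _ ha _ ha h.2 h.2)
    · rw [Finset.disjoint_left]
      intro b hb hb'
      rw [Finset.mem_filter] at hb hb'
      exact hR a ha b hb.1 hb.2 hb'.2
  have h3 := Finset.sum_le_sum h2
  have h4 := Finset.sum_lt_sum_of_nonempty hW h
  simp only [Finset.sum_add_distrib, ← Finset.mul_sum] at h3 h4
  omega

/-- A bound for the number of free directions in a partition of the exponents of `J/I` into
cylinders. -/
theorem add_card_div_two_le_of_cylinders [Fintype σ] [DecidableEq σ]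
    {U : Set (σ →₀ ℕ)} {V W : Finset (σ →₀ ℕ)} {P : Set (σ →₀ ℕ)}
    (hP : ∀ e, e ∈ P ↔ ((∃ u ∈ U, u ≤ e) ∨ ∃ w ∈ W, w ≤ e) ∧ ∀ v ∈ V, ¬ v ≤ e)
    (hU : ∀ u ∈ U, u ≠ 0) (hUW : ∀ u ∈ U, ∀ w ∈ W, Disjoint u.support w.support)
    (h0 : ∀ w ∈ V ∪ W, w ≠ 0) (hVW : Disjoint V W)
    (hd : ((V ∪ W : Finset (σ →₀ ℕ)) : Set (σ →₀ ℕ)).Pairwise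
      fun a b => Disjoint a.support b.support)
    (hne : P.Nonempty) {ι : Type*} {s : ℕ} (a : ι → σ →₀ ℕ) (Z : ι → Finset σ)
    (hs : ∀ i, s ≤ (Z i).card) (hsub : ∀ i, cylinder (a i) (Z i)ᶜ ⊆ P)
    (hcov : ∀ e ∈ P, ∃ i, e ∈ cylinder (a i) (Z i)ᶜ)
    (hdisj : ∀ e i j, e ∈ cylinder (a i) (Z i)ᶜ → e ∈ cylinder (a j) (Z j)ᶜ → i = j) :
    s + (V.card + W.card / 2) ≤ Fintype.card σ := by
  have not_le : ∀ x y : σ →₀ ℕ, x ≠ 0 → Disjoint x.support y.support → ¬ x ≤ y := by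
    intro x y hx hxy hle
    have := hxy.mono_right (Finsupp.support_mono hle)
    simp [hx] at this
  have add_mem : ∀ i e x, e ∈ cylinder (a i) (Z i)ᶜ → x.support ⊆ Z i →
      e + x ∈ cylinder (a i) (Z i)ᶜ := by
    rintro i e x ⟨h1, h2⟩ hx
    refine ⟨h1.trans le_self_add, fun j hj => ?_⟩
    have : x j = 0 := by
      by_contra h
      exact (Finset.mem_compl.1 hj) (hx (Finsupp.mem_support_iff.2 h))
    simp [this, h2 j hj]
  have base_mem : ∀ i, a i ∈ cylinder (a i) (Z i)ᶜ := fun i => ⟨le_rfl, fun _ _ => rfl⟩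
  -- If all of `v` were free, the cylinder would contain `a i + v`, an exponent of `I`.
  have hV : ∀ i, ∀ v ∈ V, ∃ x ∈ v.support, x ∈ (Z i)ᶜ := by
    intro i v hv
    by_contra! h
    have := add_mem i (a i) v (base_mem i) fun x hx => by simpa using h x hx
    exact ((hP _).1 (hsub i this)).2 v hv le_add_self
  have bound : ∀ i, ∀ N ⊆ W, (∀ w ∈ N, ∃ x ∈ w.support, x ∈ (Z i)ᶜ) →
      s + (V.card + N.card) ≤ Fintype.card σ := by
    intro i N hN hNZ
    rw [← Finset.card_union_of_disjoint (hVW.mono_right hN),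
      ← Finset.card_add_card_compl (Z i)]
    refine add_le_add (hs i) (card_le_card_of_disjoint_supports
      (hd.mono ?_) ?_)
    · exact_mod_cast Finset.union_subset_union subset_rfl hN
    · intro w hw
      exact (Finset.mem_union.1 hw).elim (hV i w) (hNZ w)
  rcases W.eq_empty_or_nonempty with rfl | hW
  · obtain ⟨e, he⟩ := hne
    obtain ⟨i, -⟩ := hcov e he
    simpa using bound i ∅ subset_rfl (by simp)
  have hWP : ∀ w ∈ W, w ∈ P := by
    intro w hw
    refine (hP w).2 ⟨Or.inr ⟨w, hw, le_rfl⟩, fun v hv => ?_⟩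
    refine not_le v w (h0 v (by simp [hv])) (hd (by simp [hv]) (by simp [hw]) ?_)
    rintro rfl
    exact Finset.disjoint_left.1 hVW hv hw
  have : Nonempty ι := ⟨(hcov _ (hWP _ hW.choose_spec)).choose⟩
  choose! f hf using fun w hw => hcov w (hWP w hw)
  -- The base lies in `J` and divides `w`, but `w` is the only generator dividing `w`.
  have hbase : ∀ w ∈ W, a (f w) = w := by
    intro w hw
    have hle : a (f w) ≤ w := (hf w hw).1
    rcases ((hP _).1 (hsub _ (base_mem (f w)))).1 with ⟨u, hu, hua⟩ | ⟨w', hw', hwa⟩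
    · exact (not_le u w (hU u hu) (hUW u hu w hw) (hua.trans hle)).elim
    · obtain rfl : w' = w := by
        by_contra hne
        exact not_le w' w (h0 w' (by simp [hw'])) (hd (by simp [hw']) (by simp [hw]) hne)
          (hwa.trans hle)
      exact le_antisymm hle hwa
  classical
  obtain ⟨w, hw, hcard⟩ := exists_card_filter_lt_of_asymm hW
    (fun w w' => w' ≠ w ∧ w'.support ⊆ Z (f w)) (by
      rintro w hw w' hw' ⟨hne, h1⟩ ⟨-, h2⟩
      have e1 := add_mem _ _ _ (hf w hw) h1
      have e2 := add_mem _ _ _ (hf w' hw') h2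
      rw [add_comm] at e2
      have := hdisj _ _ _ e1 e2
      exact hne (by rw [← hbase w hw, ← hbase w' hw', this]))
  set R : (σ →₀ ℕ) → Prop := fun w' => w' ≠ w ∧ w'.support ⊆ Z (f w) with hR
  -- The generators other than `w` that are not out-neighbours of `w` number at least `W.card / 2`,
  -- and each has a frozen direction in the cylinder of `w`.
  have h1 := bound (f w) ((W.erase w).filter fun w' => ¬ R w')
    ((Finset.filter_subset _ _).trans (Finset.erase_subset _ _)) (by
      intro w' hw'
      simp only [hR, Finset.mem_filter, Finset.mem_erase, not_and, Finset.not_subset] at hw'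
      obtain ⟨x, hx, hxZ⟩ := hw'.2 hw'.1.1
      exact ⟨x, hx, Finset.mem_compl.2 hxZ⟩)
  have h2 := Finset.card_filter_add_card_filter_not (s := W.erase w) R
  have h3 : ((W.erase w).filter R).card ≤ (W.filter R).card :=
    Finset.card_le_card (Finset.filter_subset_filter _ (Finset.erase_subset _ _))
  have h4 := Finset.card_erase_add_one hw
  change 2 * (W.filter R).card + 1 ≤ _ at hcard
  omega

end Counting

/-! ### Stanley decompositions of `J/I` as cylinder partitions -/

section QuotientBasis

open MvPolynomial

variable {K : Type*} [Field K] {n : ℕ} {J I : Ideal (MvPolynomial (Fin n) K)}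
  {A B : Set (Fin n →₀ ℕ)}

/-- The ideal consists of the polynomials all of whose exponents lie in `A`. -/
def IsMonomialIdealOf (J : Ideal (MvPolynomial (Fin n) K)) (A : Set (Fin n →₀ ℕ)) : Prop :=
  ∀ f, f ∈ J ↔ ∀ e ∈ f.support, e ∈ A

theorem IsMonomialIdealOf.monomial_mem (h : IsMonomialIdealOf J A) {e : Fin n →₀ ℕ} (he : e ∈ A)
    (c : K) : monomial e c ∈ J := by
  classical
  refine (h _).2 fun e' he' => ?_
  rw [Finset.mem_singleton.1 (support_monomial_subset he')]
  exact he

theorem IsMonomialIdealOf.mem_of_monomial_mem (h : IsMonomialIdealOf J A) {e : Fin n →₀ ℕ}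
    {c : K} (hc : c ≠ 0) (he : monomial e c ∈ J) : e ∈ A :=
  (h _).1 he e (by classical simp [support_monomial, hc])

/-- The monomials in `J` outside `I` give a basis of `J/I`. -/
theorem exists_basis_idealQuotient (hJ : IsMonomialIdealOf J A) (hI : IsMonomialIdealOf I B) :
    ∃ b : Module.Basis (A \ B : Set (Fin n →₀ ℕ)) K (IdealQuotient J I),
      ∀ (f : J) (e : (A \ B : Set (Fin n →₀ ℕ))),
        b.repr (Submodule.Quotient.mk f) e = coeff (e : Fin n →₀ ℕ) (f : MvPolynomial (Fin n) K) := by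
  -- Reading off the coefficients outside `B` has kernel `I`, since exponents of elements of `J`
  -- already lie in `A`.
  let ψ : J →ₗ[K] ((A \ B : Set (Fin n →₀ ℕ)) →₀ K) :=
    Finsupp.lsubtypeDomain (A \ B) ∘ₗ (basisMonomials (Fin n) K).repr.toLinearMap ∘ₗ
      J.subtype.restrictScalars K
  have hψ : ∀ f e, ψ f e = coeff (e : Fin n →₀ ℕ) (f : MvPolynomial (Fin n) K) := fun f e => rfl
  have hker : (Submodule.submoduleOf I J).restrictScalars K = LinearMap.ker ψ := by
    ext f
    rw [LinearMap.mem_ker, Submodule.restrictScalars_mem, Submodule.submoduleOf,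
      Submodule.mem_comap, Submodule.subtype_apply, hI, DFunLike.ext_iff]
    constructor
    · rintro h ⟨e, he⟩
      rw [hψ]
      by_contra h0
      exact he.2 (h e (mem_support_iff.2 h0))
    · intro h e he
      by_contra heB
      exact (mem_support_iff.1 he) (h ⟨e, (hJ _).1 f.2 e he, heB⟩)
  have hsurj : Function.Surjective ψ := by
    classical
    rw [← LinearMap.range_eq_top, Submodule.eq_top_iff']
    intro g
    induction g using Finsupp.induction_linear with
    | zero => exact zero_mem _
    | add f g hf hg => exact add_mem hf hg
    | single e c =>
      refine ⟨⟨monomial e c, hJ.monomial_mem e.2.1 c⟩, ?_⟩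
      ext e'
      simp [hψ, coeff_monomial, Finsupp.single_apply, Subtype.ext_iff]
  refine ⟨.ofRepr ((Submodule.Quotient.restrictScalarsEquiv K (Submodule.submoduleOf I J)).symm ≪≫ₗ
    Submodule.quotEquivOfEq _ _ hker ≪≫ₗ ψ.quotKerEquivOfSurjective hsurj), fun f e => rfl⟩

theorem mem_supported_iff_forall_support {f : MvPolynomial (Fin n) K} {Z : Finset (Fin n)} :
    f ∈ supported K (Z : Set (Fin n)) ↔ ∀ e ∈ f.support, e.support ⊆ Z := by
  rw [mem_supported, Finset.coe_subset]
  constructor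
  · exact fun h e he x hx => h (mem_vars_iff_mem_support x |>.2 ⟨e, he, hx⟩)
  · intro h x hx
    obtain ⟨e, he, hxe⟩ := (mem_vars_iff_mem_support x).1 hx
    exact h e he hxe

theorem mem_cylinder_compl_iff {a e : Fin n →₀ ℕ} {Z : Finset (Fin n)} (h : a ≤ e) :
    e ∈ cylinder a Zᶜ ↔ (e - a).support ⊆ Z := by
  constructor
  · intro he x hx
    by_contra hxZ
    have := he.2 x (Finset.mem_compl.2 hxZ)
    simp [this] at hx
  · refine fun hs => ⟨h, fun x hx => ?_⟩
    have h1 : x ∉ (e - a).support := fun hx' => Finset.mem_compl.1 hx (hs hx')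
    have h2 := h x
    simp only [Finsupp.mem_support_iff, Finsupp.coe_tsub, Pi.sub_apply, not_not] at h1
    omega

/-- The Stanley space of a monomial is spanned by the basis vectors in a cylinder. -/
theorem stanleySpace_eq_span
    (b : Module.Basis (A \ B : Set (Fin n →₀ ℕ)) K (IdealQuotient J I))
    (hb : ∀ (f : J) (e : (A \ B : Set (Fin n →₀ ℕ))),
        b.repr (Submodule.Quotient.mk f) e = coeff (e : Fin n →₀ ℕ) (f : MvPolynomial (Fin n) K))
    (g : J) (a : Fin n →₀ ℕ) {c : K} (hc : c ≠ 0)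
    (hg : (g : MvPolynomial (Fin n) K) = monomial a c) (Z : Finset (Fin n)) :
    stanleySpace (K := K) (Submodule.Quotient.mk g : IdealQuotient J I) Z =
      Submodule.span K (b '' {e | (e : Fin n →₀ ℕ) ∈ cylinder a Zᶜ}) := by
  have hcoeff : ∀ (f : MvPolynomial (Fin n) K) (e : (A \ B : Set (Fin n →₀ ℕ))),
      b.repr (f • (Submodule.Quotient.mk g : IdealQuotient J I)) e =
        if a ≤ e then coeff ((e : Fin n →₀ ℕ) - a) f * c else 0 := by
    intro f e
    rw [← Submodule.Quotient.mk_smul, hb]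
    simp only [Submodule.coe_smul, smul_eq_mul, hg, coeff_mul_monomial']
  apply le_antisymm
  · rintro _ ⟨f, hf, rfl⟩
    replace hf := mem_supported_iff_forall_support.1 hf
    rw [Module.Basis.mem_span_image]
    intro e he
    rw [Finset.mem_coe, Finsupp.mem_support_iff] at he
    rw [LinearMap.restrictScalars_apply, LinearMap.toSpanSingleton_apply] at he
    rw [hcoeff] at he
    split_ifs at he with hae
    · exact (mem_cylinder_compl_iff hae).2
        (hf _ (mem_support_iff.2 fun h => he (by rw [h, zero_mul])))
    · exact (he rfl).elim
  · rw [Submodule.span_le]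
    rintro _ ⟨e, he, rfl⟩
    classical
    refine ⟨monomial ((e : Fin n →₀ ℕ) - a) c⁻¹, mem_supported_iff_forall_support.2 ?_, ?_⟩
    · intro e' he'
      rw [Finset.mem_singleton.1 (support_monomial_subset he')]
      exact (mem_cylinder_compl_iff he.1).1 he
    · apply b.repr.injective
      ext e'
      rw [LinearMap.restrictScalars_apply, LinearMap.toSpanSingleton_apply, hcoeff, Module.Basis.repr_self, coeff_monomial, Finsupp.single_apply]
      by_cases h : e = e'
      · subst h
        simp [show a ≤ (e : Fin n →₀ ℕ) from he.1, hc]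
      · rw [if_neg h]
        split_ifs with h1 h2
        · refine (h (Subtype.ext ?_)).elim
          rw [← tsub_add_cancel_of_le he.1, h2, tsub_add_cancel_of_le h1]
        · simp
        · rfl

theorem isInternal_span_basis {ι κ V : Type*} [DecidableEq κ] [AddCommGroup V] [Module K V]
    (b : Module.Basis ι K V) (s : κ → Set ι) (hcov : ∀ i, ∃ k, i ∈ s k)
    (hdisj : ∀ i k l, i ∈ s k → i ∈ s l → k = l) :
    DirectSum.IsInternal fun k => Submodule.span K (b '' s k) := by
  refine DirectSum.isInternal_submodule_of_iSupIndep_of_iSup_eq_top ?_ ?_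
  · intro k
    have h1 : (⨆ (l) (_ : l ≠ k), Submodule.span K (b '' s l)) ≤
        Submodule.span K (b '' (s k)ᶜ) := by
      refine iSup₂_le fun l hl => Submodule.span_mono (Set.image_mono fun i hi hk => ?_)
      exact hl (hdisj i l k hi hk)
    refine Disjoint.mono_right h1 ?_
    rw [Submodule.disjoint_def]
    intro x hx hx'
    rw [Module.Basis.mem_span_image] at hx hx'
    have : b.repr x = 0 := by
      ext i
      by_contra h
      have hi : i ∈ (b.repr x).support := Finsupp.mem_support_iff.2 h
      exact hx' hi (hx hi)
    simpa using this
  · rw [eq_top_iff, ← b.span_eq, Submodule.span_le]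
    rintro _ ⟨i, rfl⟩
    obtain ⟨k, hk⟩ := hcov i
    exact Submodule.mem_iSup_of_mem k (Submodule.subset_span ⟨i, hk, rfl⟩)

/-- A partition of the exponents of `J/I` into cylinders gives a Stanley decomposition. -/
theorem exists_stanleyDecomposition (hJ : IsMonomialIdealOf J A) (hI : IsMonomialIdealOf I B)
    (hne : (A \ B).Nonempty) {V : Finset (Fin n)} {c : ℕ}
    (h : HasCylinderPartition V c (A \ B)) :
    ∃ D : StanleyDecomposition (idealQuotientGrading J I), n - c ≤ D.sdepth := by
  obtain ⟨b, hb⟩ := exists_basis_idealQuotient hJ hI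
  obtain ⟨D, h1, h2, h3⟩ := h
  let d : Fin D.card → (Fin n →₀ ℕ) × Finset (Fin n) := fun i => D.equivFin.symm i
  have hd : ∀ i, d i ∈ D := fun i => (D.equivFin.symm i).2
  have hmem : ∀ i e, e ∈ cylinder (d i).1 (d i).2 → e ∈ A \ B := fun i e he =>
    (h2 e).2 ⟨d i, hd i, he⟩
  have hbase : ∀ i, (d i).1 ∈ A \ B := fun i => hmem i _ ⟨le_rfl, fun _ _ => rfl⟩
  let g : Fin D.card → J := fun i => ⟨monomial (d i).1 1, hJ.monomial_mem (hbase i).1 1⟩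
  have hsp : ∀ i, stanleySpace (K := K) (Submodule.Quotient.mk (g i) : IdealQuotient J I)
      (d i).2ᶜ = Submodule.span K (b '' {e | (e : Fin n →₀ ℕ) ∈ cylinder (d i).1 (d i).2}) := by
    intro i
    have := stanleySpace_eq_span b hb (g i) (d i).1 one_ne_zero rfl (d i).2ᶜ
    rwa [compl_compl] at this
  have hcov : ∀ e ∈ A \ B, ∃ i, e ∈ cylinder (d i).1 (d i).2 := by
    intro e he
    obtain ⟨x, hx, hex⟩ := (h2 e).1 he
    exact ⟨D.equivFin ⟨x, hx⟩, by simpa [d] using hex⟩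
  refine ⟨⟨D.card, fun i => Submodule.Quotient.mk (g i), fun i => (d i).2ᶜ, ?_, ?_, ?_⟩, ?_⟩
  · refine fun i => ⟨fun j => (d i).1 j, g i, ?_, rfl⟩
    intro e he j
    rw [Finset.mem_singleton.1 (support_monomial_subset he)]
  · intro i f hf f' hf' hff
    rw [← sub_eq_zero]
    by_contra hne
    obtain ⟨e, he⟩ := MvPolynomial.ne_zero_iff.1 hne
    have hsub : f - f' ∈ supported K ((d i).2ᶜ : Finset (Fin n)) := sub_mem hf hf'
    -- This exponent lies outside `B`, so its coefficient in `(f - f') • g i`, which is that of `f -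
    -- f'` at `e`, survives in `J/I`.
    have hcyl : e + (d i).1 ∈ cylinder (d i).1 (d i).2 := by
      have := mem_cylinder_compl_iff (a := (d i).1) (e := e + (d i).1) (Z := (d i).2ᶜ)
        le_add_self
      rw [compl_compl] at this
      rw [this, add_tsub_cancel_right]
      exact mem_supported_iff_forall_support.1 hsub e (mem_support_iff.2 he)
    have h0 : (f - f') • (Submodule.Quotient.mk (g i) : IdealQuotient J I) = 0 := by
      rw [sub_smul, sub_eq_zero]; exact hff
    have := hb ((f - f') • g i) ⟨_, hmem i _ hcyl⟩
    rw [Submodule.Quotient.mk_smul, h0, map_zero, Finsupp.zero_apply] at this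
    simp only [Submodule.coe_smul, smul_eq_mul, g, coeff_mul_monomial', le_add_self, if_true,
      add_tsub_cancel_right, mul_one] at this
    exact he this.symm
  · simp only [hsp]
    refine isInternal_span_basis b _ (fun e => hcov e e.2) fun e i j hi hj => ?_
    have := h3 e (d i) (hd i) (d j) (hd j) hi hj
    exact D.equivFin.symm.injective (Subtype.ext this)
  · obtain ⟨e, he⟩ := hne
    have : Nonempty (Fin D.card) := ⟨(hcov e he).choose⟩
    refine le_ciInf fun i => ?_
    change _ ≤ ((d i).2ᶜ).card
    rw [Finset.card_compl, Fintype.card_fin]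
    exact Nat.sub_le_sub_left (h1 _ (hd i)).2.2 _

/-- A Stanley decomposition of `J/I` gives a partition of its exponents into cylinders. -/
theorem StanleyDecomposition.exists_cylinders (hJ : IsMonomialIdealOf J A)
    (hI : IsMonomialIdealOf I B) (D : StanleyDecomposition (idealQuotientGrading J I)) :
    ∃ a : Fin D.r → Fin n →₀ ℕ, (∀ i, cylinder (a i) (D.Z i)ᶜ ⊆ A \ B) ∧
      (∀ e ∈ A \ B, ∃ i, e ∈ cylinder (a i) (D.Z i)ᶜ) ∧
      ∀ e i j, e ∈ cylinder (a i) (D.Z i)ᶜ → e ∈ cylinder (a j) (D.Z j)ᶜ → i = j := by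
  obtain ⟨b, hb⟩ := exists_basis_idealQuotient hJ hI
  have hm : ∀ i, ∃ (a : Fin n →₀ ℕ) (c : K) (g : J), c ≠ 0 ∧
      (g : MvPolynomial (Fin n) K) = monomial a c ∧ Submodule.Quotient.mk g = D.m i := by
    intro i
    obtain ⟨d, g, hg, hgm⟩ := D.homogeneous i
    change Submodule.Quotient.mk g = D.m i at hgm
    -- Freeness forces `D.m i ≠ 0`. Homogeneity then leaves the lift `g` a single exponent, so it is
    -- a term.
    have hg0 : (g : MvPolynomial (Fin n) K) ≠ 0 := by
      intro h0
      have h1 : D.m i = 0 := by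
        rw [← hgm, show g = 0 from Subtype.ext h0, Submodule.Quotient.mk_zero]
      exact one_ne_zero (D.free i (one_mem _) (zero_mem _) (by simp [h1]))
    obtain ⟨a, ha⟩ := MvPolynomial.ne_zero_iff.1 hg0
    refine ⟨a, coeff a (g : MvPolynomial (Fin n) K), g, ha, ?_, hgm⟩
    classical
    ext e
    rw [coeff_monomial]
    split_ifs with h
    · rw [h]
    · by_contra he
      refine h (Finsupp.ext fun j => ?_)
      have h1 := hg a (mem_support_iff.2 ha) j
      have h2 := hg e (mem_support_iff.2 he) j
      exact_mod_cast h1.trans h2.symm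
  choose a c g hc hg hgm using hm
  have hsp : ∀ i, stanleySpace (K := K) (D.m i) (D.Z i) =
      Submodule.span K (b '' {e | (e : Fin n →₀ ℕ) ∈ cylinder (a i) (D.Z i)ᶜ}) := fun i => by
    rw [← hgm]
    exact stanleySpace_eq_span b hb (g i) (a i) (hc i) (hg i) (D.Z i)
  have hsub : ∀ i, cylinder (a i) (D.Z i)ᶜ ⊆ A \ B := by
    intro i e he
    have hmul : monomial (e - a i) (1 : K) * (g i : MvPolynomial (Fin n) K) =
        monomial e (c i) := by
      rw [hg, monomial_mul, tsub_add_cancel_of_le he.1, one_mul]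
    refine ⟨hJ.mem_of_monomial_mem (hc i) (hmul ▸ J.mul_mem_left _ (g i).2), fun heB => ?_⟩
    have h0 : monomial (e - a i) (1 : K) • D.m i = (0 : MvPolynomial (Fin n) K) • D.m i := by
      rw [zero_smul, ← hgm, ← Submodule.Quotient.mk_smul, Submodule.Quotient.mk_eq_zero]
      change monomial (e - a i) (1 : K) * (g i : MvPolynomial (Fin n) K) ∈ I
      rw [hmul]
      exact hI.monomial_mem heB _
    have hs : monomial (e - a i) (1 : K) ∈ supported K (D.Z i : Set (Fin n)) := by
      rw [mem_supported_iff_forall_support]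
      intro e' he'
      rw [Finset.mem_singleton.1 (support_monomial_subset he')]
      exact (mem_cylinder_compl_iff he.1).1 he
    have := D.free i hs (zero_mem _) h0
    rw [monomial_eq_zero] at this
    exact one_ne_zero this
  refine ⟨a, hsub, fun e he => ?_, fun e i j hi hj => ?_⟩
  -- An exponent missed by every cylinder would put all the Stanley spaces in the span of the other
  -- basis vectors.
  · by_contra! h
    have h1 := D.isInternal.submodule_iSup_eq_top
    have h2 : (⨆ i, stanleySpace (K := K) (D.m i) (D.Z i)) ≤
        Submodule.span K (b '' {⟨e, he⟩}ᶜ) := by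
      refine iSup_le fun i => ?_
      rw [hsp]
      refine Submodule.span_mono (Set.image_mono fun x hx hxe => ?_)
      rw [Set.mem_singleton_iff] at hxe
      exact h i (by rw [hxe] at hx; exact hx)
    rw [h1] at h2
    have h3 : b ⟨e, he⟩ ∈ Submodule.span K (b '' {⟨e, he⟩}ᶜ) := h2 trivial
    rw [Module.Basis.self_mem_span_image] at h3
    exact h3 rfl
  · by_contra hij
    have h1 := D.isInternal.submodule_iSupIndep.pairwiseDisjoint hij
    simp only [Function.onFun, hsp] at h1
    rw [Submodule.disjoint_def] at h1
    exact b.ne_zero ⟨e, hsub i hi⟩ (h1 _ (Submodule.subset_span ⟨_, hi, rfl⟩)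
      (Submodule.subset_span ⟨_, hj, rfl⟩))

end QuotientBasis

/-! ### The Stanley depth formula -/

open MvPolynomial in
theorem isMonomialIdealOf_span_range {K : Type*} [Field K] {n : ℕ} {ι : Type*}
    (a : ι → Fin n →₀ ℕ) :
    IsMonomialIdealOf (Ideal.span (Set.range fun i => monomial (a i) (1 : K)))
      {e | ∃ i, a i ≤ e} := by
  intro f
  have : (Set.range fun i => monomial (a i) (1 : K)) =
      (fun s => monomial s (1 : K)) '' Set.range a := by
    rw [← Set.range_comp]; rfl
  rw [this, mem_ideal_span_monomial_image]
  simp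

theorem theorem2p9 {K : Type*} [Field K] (n p q : ℕ) (hpq : p ≤ q)
    (u : Fin q → MvPolynomial (Fin n) K) (v : Fin p → MvPolynomial (Fin n) K)
    (hu : ∀ i, IsMonomial (u i)) (hv : ∀ i, IsMonomial (v i))
    (hureg : RingTheory.Sequence.IsRegular (MvPolynomial (Fin n) K) (List.ofFn u))
    (hvreg : RingTheory.Sequence.IsRegular (MvPolynomial (Fin n) K) (List.ofFn v))
    (hdvd : ∀ i : Fin p, u (Fin.castLE hpq i) ∣ v i)
    (J I : Ideal (MvPolynomial (Fin n) K))
    (hJ : J = Ideal.span (Set.range u)) (hI : I = Ideal.span (Set.range v))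
    (hIJ : I ≠ J)
    (htail : RingTheory.Sequence.IsRegular (MvPolynomial (Fin n) K ⧸ I)
      ((List.ofFn u).drop p)) :
    Nonempty (StanleyDecomposition (idealQuotientGrading J I)) ∧
      (stanleyDepth (idealQuotientGrading J I) : ℤ) =
        (n : ℤ) - (p : ℤ) - ⌊((q : ℚ) - (p : ℚ)) / 2⌋ := by
  choose a ha using hu
  choose b hb using hv
  obtain rfl : u = fun i => MvPolynomial.monomial (a i) 1 := funext ha
  obtain rfl : v = fun i => MvPolynomial.monomial (b i) 1 := funext hb
  clear ha hb
  have hmap : ∀ {m : ℕ} (c : Fin m → Fin n →₀ ℕ),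
      List.ofFn (fun i => MvPolynomial.monomial (c i) (1 : K)) =
        (List.ofFn c).map fun w => MvPolynomial.monomial w (1 : K) := fun c => by
    rw [List.map_ofFn]; rfl
  simp only [hmap] at hureg hvreg htail
  rw [← List.map_drop] at htail
  set t := (List.ofFn a).drop p with ht
  have hab : ∀ i : Fin p, a (Fin.castLE hpq i) ≤ b i := by
    intro i
    have := hdvd i
    rw [MvPolynomial.monomial_dvd_monomial] at this
    simpa using this.1
  have ha0 : ∀ w ∈ List.ofFn a, w ≠ 0 := fun w => ne_zero_of_isRegular hureg
  have hb0 : ∀ w ∈ List.ofFn b, w ≠ 0 := fun w => ne_zero_of_isRegular hvreg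
  have ht0 : ∀ w ∈ t, w ≠ 0 := fun w hw => ha0 w (List.mem_of_mem_drop hw)
  have h0 : ∀ w ∈ List.ofFn b ++ t, w ≠ 0 := fun w hw =>
    (List.mem_append.1 hw).elim (hb0 w) (ht0 w)
  have hIlist : I = Ideal.ofList ((List.ofFn b).map fun w => MvPolynomial.monomial w (1 : K)) := by
    rw [hI, Ideal.ofList, ← hmap]
    congr 1
    ext; simp [List.mem_ofFn]
  have hd : DisjointSupports (List.ofFn b ++ t) := by
    refine disjointSupports_of_isWeaklyRegular (R := K) _ h0 ?_
    rw [List.map_append]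
    exact isWeaklyRegular_append hIlist hvreg.toIsWeaklyRegular htail.toIsWeaklyRegular
  have htlen : t.length = q - p := by simp [ht]
  have hamem : ∀ e, (∃ i, a i ≤ e) ↔ (∃ i : Fin p, a (Fin.castLE hpq i) ≤ e) ∨ ∃ w ∈ t, w ≤ e := by
    intro e
    have h1 : (∃ i, a i ≤ e) ↔ ∃ w ∈ List.ofFn a, w ≤ e := by simp [List.mem_ofFn]
    have h2 : List.ofFn a = (List.ofFn fun i : Fin p => a (Fin.castLE hpq i)) ++ t := by
      rw [← List.take_append_drop p (List.ofFn a), ← ht]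
      congr 1
      refine List.ext_getElem (by simp [hpq]) fun i _ _ => ?_
      simp
    rw [h1, h2]
    simp only [List.mem_append, or_and_right, exists_or, List.mem_ofFn, exists_exists_eq_and]
  have hJA := isMonomialIdealOf_span_range (K := K) a
  have hIB := isMonomialIdealOf_span_range (K := K) b
  rw [← hJ] at hJA
  rw [← hI] at hIB
  set P : Set (Fin n →₀ ℕ) := {e | ∃ i, a i ≤ e} \ {e | ∃ i, b i ≤ e} with hPdef
  -- Here `I ≠ J` enters: with `P` empty, the depth would take its default value `0`.
  have hne : P.Nonempty := by
    by_contra h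
    rw [Set.not_nonempty_iff_eq_empty, hPdef, Set.sdiff_eq_empty] at h
    refine hIJ (le_antisymm ?_ fun f hf => (hIB f).2 fun e he => h ((hJA f).1 hf e he))
    intro f hf
    refine (hJA f).2 fun e he => ?_
    obtain ⟨i, hi⟩ := (hIB f).1 hf e he
    exact ⟨_, (hab i).trans hi⟩
  have hpart : HasCylinderPartition (listSupport (List.ofFn b ++ t)) (p + (q - p) / 2) P := by
    have h := hasCylinderPartition_quotient
      (List.ofFn fun i : Fin p => (a (Fin.castLE hpq i), b i)) t
      (by simpa [List.mem_ofFn] using hab) (by rw [List.map_ofFn]; exact hd)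
    rw [List.length_ofFn, htlen, List.map_ofFn] at h
    have hP : P = {e | ((∃ x ∈ List.ofFn fun i : Fin p => (a (Fin.castLE hpq i), b i), x.1 ≤ e) ∨
        ∃ w ∈ t, w ≤ e) ∧ ∀ x ∈ List.ofFn fun i : Fin p => (a (Fin.castLE hpq i), b i),
        ¬ x.2 ≤ e} := by
      ext e
      simp [hPdef, hamem, List.mem_ofFn]
    rw [hP]
    exact h
  obtain ⟨D, hD⟩ := exists_stanleyDecomposition hJA hIB hne hpart
  have hupper : ∀ D : StanleyDecomposition (idealQuotientGrading J I),
      D.sdepth + (p + (q - p) / 2) ≤ n := by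
    intro D
    obtain ⟨c, hc1, hc2, hc3⟩ := D.exists_cylinders hJA hIB
    have hsymm : Std.Symm fun a b : Fin n →₀ ℕ => Disjoint a.support b.support :=
      ⟨fun _ _ h => h.symm⟩
    have hnodup : (List.ofFn b ++ t).Nodup := by
      refine List.Pairwise.imp_of_mem (fun {x y} hx hy hxy => ?_) hd
      rintro rfl
      exact h0 x hx (by simpa using hxy)
    obtain ⟨hn1, hn2, hn3⟩ := List.nodup_append'.1 hnodup
    have := add_card_div_two_le_of_cylinders (P := P)
      (U := Set.range fun i : Fin p => a (Fin.castLE hpq i)) (V := (List.ofFn b).toFinset)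
      (W := t.toFinset) (by
        intro e
        simp [hPdef, hamem, List.mem_ofFn])
      (by rintro _ ⟨i, rfl⟩; exact ha0 _ (by simp [List.mem_ofFn]))
      (by
        rintro _ ⟨i, rfl⟩ w hw
        exact ((List.pairwise_append.1 hd).2.2 (b i) (by simp [List.mem_ofFn]) w
          (by simpa using hw)).mono_left (Finsupp.support_mono (hab i)))
      (by
        intro w hw
        exact h0 w (by simpa using hw))
      (List.disjoint_toFinset_iff_disjoint.2 hn3)
      (by
        intro x hx y hy hxy
        exact hd.forall (by simpa using hx) (by simpa using hy) hxy)
      hne c D.Z (s := D.sdepth) (fun i => ciInf_le (OrderBot.bddBelow _) i) hc1 hc2 hc3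
    rwa [List.toFinset_card_of_nodup hn1, List.toFinset_card_of_nodup hn2, List.length_ofFn,
      htlen, Fintype.card_fin] at this
  refine ⟨⟨D⟩, ?_⟩
  obtain ⟨⟨D', hD'⟩, hmax⟩ := isGreatest_stanleyDepth (idealQuotientGrading J I) ⟨D⟩
  have h1 := hupper D'
  have h2 : D.sdepth ≤ stanleyDepth (idealQuotientGrading J I) := hmax ⟨D, rfl⟩
  have hfloor : ⌊((q : ℚ) - (p : ℚ)) / 2⌋ = (((q - p) / 2 : ℕ) : ℤ) := by
    rw [← Nat.cast_sub hpq]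
    exact_mod_cast Rat.floor_natCast_div_natCast (q - p) 2
  -- The truncated subtraction in `hD` is harmless, because `h1` also gives `p + (q - p) / 2 ≤ n`.
  simp only at hD'
  rw [hfloor]
  omega
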